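/- Let $A$ be a unital $C^*$-algebra and let $\mathrm{Re}(A)$ be the real vector space of its self-adjoint elements. An \emph{isocone} of $A$ is a norm-closed subset $I\subset\mathrm{Re}(A)$ which contains $x\cdot 1$ for every $x\in\mathbb R$, is stable under sums, satisfies $\varphi(b)\in I$ for every $b\in I$ and every continuous non-decreasing $\varphi:\mathbb R\to\mathbb R$ (continuous functional calculus), and is such that $I-I$ is dense in $\mathrm{Re}(A)$. Its interior $\mathrm{int}(I)$ is taken in $\mathrm{Re}(A)$. For $a\in\mathrm{Re}(A)$, the isocone $I$ induces a relation on the spectrum $\sigma(a)$: $\lambda\preceq_a\mu$ if and only if $f(\lambda)\le f(\mu)$ for every continuous $f:\sigma(a)\to\mathbb R$ with $f(a)\in I$. If $\sigma(a)$ consists of exactly $N$ real numbers $s_a(1)<\dots<s_a(N)$, let $\le_a$ be the relation on $\{1,\dots,N\}$ defined by $i\le_a j\iff s_a(i)\preceq_a s_a(j)$. A Hermitian $N\times N$ matrix is called non-derogatory if it has no multiple eigenvalue. Let $S_N$ be the set of non-derogatory Hermitian $N\times N$ matrices. (1) Let $A=\bigoplus_{x=1}^k M_{n_x}(\mathbb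 C)\subset M_N(\mathbb C)$ (block-diagonal matrices), $N=\sum_{x=1}^k n_x$, and let $I$ be an isocone of $A$. For every $a\in\mathrm{int}(I)\cap S_N$, the relation $\le_a$ is a partial order on $\{1,\dots,N\}$, and there is $\varepsilon>0$ such that every self-adjoint $a'\in A$ with $\|a-a'\|<\varepsilon$ satisfies $a'\in\mathrm{int}(I)\cap S_N$ and $\le_{a'}\,=\,\le_a$. (2) Let $I$ be an isocone of $M_N(\mathbb C)$. There is exactly one partial order $\preceq$ on $\{1,\dots,N\}$ such that $\le_a\,=\,\preceq$ for all $a\in\mathrm{int}(I)\cap S_N$. (It is called the inner ordering of $I$.) -/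

import Mathlib

open scoped Matrix.Norms.L2Operator Pointwise

noncomputable section

/-- `f(a)`, the continuous functional calculus of a self-adjoint element `a` of a unital
C⋆-algebra, as a self-adjoint element. -/
def applyFun {A : Type*} [CStarAlgebra A] (f : ℝ → ℝ) (a : selfAdjoint A) : selfAdjoint A :=
  ⟨cfc f (a : A), cfc_predicate f (a : A)⟩

/-- Isocones of a unital C⋆-algebra `A`: closed subsets of the self-adjoint part of `A` that contain
the real constants, are stable under sums and under continuous non-decreasing functional calculus,
and whose differences are dense in the self-adjoint part. -/
structure IsIsocone {A : Type*} [CStarAlgebra A] (I : Set (selfAdjoint A)) : Prop where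
  const_mem : ∀ x : ℝ, x • (1 : selfAdjoint A) ∈ I
  add_mem : ∀ b ∈ I, ∀ b' ∈ I, b + b' ∈ I
  applyFun_mem : ∀ φ : ℝ → ℝ, Continuous φ → Monotone φ → ∀ b ∈ I, applyFun φ b ∈ I
  isClosed : IsClosed I
  dense_sub : Dense (I - I)

/-- The relation induced by `I` on the spectrum of `a`. The self-adjoint elements of `C⋆(a)` are the
`f(a)` with `f` a continuous real function on `σ(a)`, and the character of `C⋆(a)` attached to
`l ∈ σ(a)` takes `f(a)` to `f l`; so `l` is below `m` iff the character of `l` is at most the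
character of `m` on all of `I ∩ C⋆(a)`. -/
def SpectrumLE {A : Type*} [CStarAlgebra A] (I : Set (selfAdjoint A)) (a : selfAdjoint A)
    (l m : spectrum ℝ (a : A)) : Prop :=
  ∀ f : ℝ → ℝ, ContinuousOn f (spectrum ℝ (a : A)) → applyFun f a ∈ I → f l ≤ f m

/-- The relation `≤_a` on `{1, …, N}`: the relation induced by `I` on the spectrum of `a`,
transported along the increasing enumeration `s` of the spectrum (which is unique, and
exists iff the spectrum has exactly `N` elements). -/
def IndexLE {A : Type*} [CStarAlgebra A] (I : Set (selfAdjoint A)) (a : selfAdjoint A) {N : ℕ}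
    (i j : Fin N) : Prop :=
  ∃ s : Fin N ≃o spectrum ℝ (a : A), SpectrumLE I a (s i) (s j)

/-- All eigenvalues are simple (as roots of the characteristic polynomial). -/
def NonDerogatory {ι : Type*} [Fintype ι] [DecidableEq ι] (M : Matrix ι ι ℂ) : Prop :=
  M.charpoly.roots.Nodup

/-- The direct sum of the matrix algebras `M_{n_x}(ℂ)`. Its embedding in `M_N(ℂ)`, with
`N = ∑ x, n x`, is `Matrix.blockDiagonal'`. -/
abbrev BlockAlgebra {k : ℕ} (n : Fin k → ℕ) : Type :=
  ∀ x : Fin k, Matrix (Fin (n x)) (Fin (n x)) ℂ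

end

open Filter Topology Module

/-! ### Isocones and functional calculus -/

section Generic

variable {A : Type*} [CStarAlgebra A]

/-! The relation `≤_a` is determined by the finitely many sets `U` of eigenvalues whose spectral
projection lies in `I`: thresholding a function that violates `i ≤_a j` gives such a `U` with `i ∈
U` and `j ∉ U` (`not_indexLE_iff`). For `a` interior, this membership is locally constant
(`exists_eventually_projMem_iff`). Non-membership is open because `I` is closed. If the projection
`p` is in `I`, then `p + εa` is interior, so its analogue for a nearby `a'` is still in `I`, and a
threshold recovers the projection of `a'`. Spectra with `N` points move continuously, as no spectrum
is larger. This gives (1). For (2), local constancy must become constancy on the non-derogatory part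
of the convex open set `int(I)`. The lines from `x` through derogatory matrices fill only a set of
smaller Hausdorff dimension (`dense_nonDerogatory_cone`), so a generic `z` is joined to two given
points by segments free of derogatory matrices. -/

noncomputable instance selfAdjointNormedSpace : NormedSpace ℝ (selfAdjoint A) where
  norm_smul_le r a := norm_smul_le r (a : A)

theorem applyFun_congr {f g : ℝ → ℝ} {a : selfAdjoint A}
    (h : ∀ x ∈ spectrum ℝ (a : A), f x = g x) : applyFun f a = applyFun g a :=
  Subtype.ext (cfc_congr h)

theorem continuous_applyFun {f : ℝ → ℝ} (hf : Continuous f) :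
    Continuous (applyFun f : selfAdjoint A → selfAdjoint A) := by
  refine Continuous.subtype_mk ?_ _
  exact Continuous.cfc_of_mem_nhdsSet (s := Set.univ) f univ_mem
    continuous_subtype_val (fun a => a.2) hf.continuousOn

theorem applyFun_applyFun {f g : ℝ → ℝ} {a : selfAdjoint A} (hg : Continuous g)
    (hf : ContinuousOn f (spectrum ℝ (a : A))) :
    applyFun g (applyFun f a) = applyFun (fun x => g (f x)) a :=
  Subtype.ext (cfc_comp' g f (a : A) (hg.continuousOn) hf a.2).symm

theorem applyFun_id (a : selfAdjoint A) : applyFun (fun x => x) a = a :=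
  Subtype.ext (cfc_id' ℝ (a : A) a.2)

theorem applyFun_const_mul (t : ℝ) (a : selfAdjoint A) : applyFun (fun x => t * x) a = t • a := by
  refine Subtype.ext ?_
  exact cfc_const_mul_id t (a : A) a.2

theorem applyFun_add_const_mul {f : ℝ → ℝ} (t : ℝ) (a : selfAdjoint A)
    (hf : ContinuousOn f (spectrum ℝ (a : A))) :
    applyFun (fun x => f x + t * x) a = applyFun f a + t • a := by
  rw [← applyFun_const_mul]
  exact Subtype.ext (cfc_add (a : A) f (fun x => t * x) hf (by fun_prop))

namespace IsIsocone

variable {I : Set (selfAdjoint A)}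

theorem smul_mem (hI : IsIsocone I) {t : ℝ} (ht : 0 ≤ t) {a : selfAdjoint A} (ha : a ∈ I) :
    t • a ∈ I := by
  rw [← applyFun_const_mul]
  exact hI.applyFun_mem _ (by fun_prop) (fun x y h => mul_le_mul_of_nonneg_left h ht) a ha

theorem convex (hI : IsIsocone I) : Convex ℝ I := fun _ hx _ hy _ _ hs ht _ =>
  hI.add_mem _ (hI.smul_mem hs hx) _ (hI.smul_mem ht hy)

theorem zero_mem (hI : IsIsocone I) : (0 : selfAdjoint A) ∈ I := by simpa using hI.const_mem 0

theorem add_smul_mem_interior (hI : IsIsocone I) {t : ℝ} (ht : 0 < t) {a b : selfAdjoint A}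
    (ha : a ∈ interior I) (hb : b ∈ I) : b + t • a ∈ interior I := by
  have h1 : t • a ∈ interior I := by
    have : t • interior I ⊆ interior I := by
      refine interior_maximal ?_ (isOpen_interior.smul₀ ht.ne')
      rintro _ ⟨c, hc, rfl⟩
      exact hI.smul_mem ht.le (interior_subset hc)
    exact this ⟨a, ha, rfl⟩
  have h2 : (fun x => b + x) '' interior I ⊆ interior I := by
    refine interior_maximal ?_ ((Homeomorph.addLeft b).isOpenMap _ isOpen_interior)
    rintro _ ⟨c, hc, rfl⟩
    exact hI.add_mem _ hb _ (interior_subset hc)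
  exact h2 ⟨_, h1, rfl⟩

theorem applyFun_id_mem {a : selfAdjoint A} (ha : a ∈ I) :
    applyFun (fun x => x) a ∈ I := by rwa [applyFun_id]

/-- In finite dimension the direction space of the span of `I` is closed; it contains the dense set
`I - I`, so the convex set `I` is full-dimensional. -/
theorem interior_nonempty [FiniteDimensional ℝ (selfAdjoint A)] (hI : IsIsocone I) :
    (interior I).Nonempty := by
  rw [hI.convex.interior_nonempty_iff_affineSpan_eq_top,
    AffineSubspace.affineSpan_eq_top_iff_vectorSpan_eq_top_of_nonempty ℝ _ _ ⟨0, hI.zero_mem⟩]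
  have hcl : IsClosed (vectorSpan ℝ I : Set (selfAdjoint A)) :=
    Submodule.closed_of_finiteDimensional _
  have hsub : I - I ⊆ (vectorSpan ℝ I : Set (selfAdjoint A)) := by
    rintro _ ⟨x, hx, y, hy, rfl⟩
    exact vsub_mem_vectorSpan ℝ hx hy
  refine SetLike.coe_injective ?_
  rw [← hcl.closure_eq]
  exact (hI.dense_sub.mono hsub).closure_eq

end IsIsocone

/-! ### Spectral projections and the relation `≤_a` -/

/-- A threshold function: continuous, non-decreasing, `0` up to `u` and `1` from `v` on. -/
theorem exists_threshold {u v : ℝ} (h : u < v) : ∃ φ : ℝ → ℝ, Continuous φ ∧ Monotone φ ∧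
    (∀ x ≤ u, φ x = 0) ∧ ∀ x, v ≤ x → φ x = 1 := by
  have hd : 0 < v - u := sub_pos.2 h
  refine ⟨fun x => max 0 (min 1 ((x - u) / (v - u))), by fun_prop, ?_, ?_, ?_⟩
  · intro x y hxy
    have : (x - u) / (v - u) ≤ (y - u) / (v - u) := by gcongr
    exact max_le_max le_rfl (min_le_min le_rfl this)
  · intro x hx
    exact max_eq_left (min_le_of_right_le (div_nonpos_of_nonpos_of_nonneg (by linarith) hd.le))
  · intro x hx
    have : 1 ≤ (x - u) / (v - u) := by rw [le_div_iff₀ hd]; linarith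
    simp [min_eq_left this]

/-- The spectral projection of `a` on the set `U` of (indices of) eigenvalues belongs to `I`. -/
def ProjMem (I : Set (selfAdjoint A)) (a : selfAdjoint A) {N : ℕ}
    (s : Fin N ≃o spectrum ℝ (a : A)) (U : Finset (Fin N)) : Prop :=
  ∃ f : ℝ → ℝ, ContinuousOn f (spectrum ℝ (a : A)) ∧ applyFun f a ∈ I ∧
    ∀ k, f (s k) = if k ∈ U then 1 else 0

variable {I : Set (selfAdjoint A)} {N : ℕ}

theorem projMem_iff {a : selfAdjoint A} {s : Fin N ≃o spectrum ℝ (a : A)} {U : Finset (Fin N)}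
    {f : ℝ → ℝ} (hf : Continuous f) (hfU : ∀ k, f (s k) = if k ∈ U then 1 else 0) :
    ProjMem I a s U ↔ applyFun f a ∈ I := by
  refine ⟨fun ⟨g, _, hg, hgU⟩ => ?_, fun h => ⟨f, hf.continuousOn, h, hfU⟩⟩
  convert hg using 1
  refine applyFun_congr fun x hx => ?_
  obtain ⟨k, hk⟩ := s.surjective ⟨x, hx⟩
  have := hfU k
  rw [← hgU k, hk] at this
  exact this

theorem indexLE_iff {a : selfAdjoint A} (s : Fin N ≃o spectrum ℝ (a : A)) (i j : Fin N) :
    IndexLE I a i j ↔ SpectrumLE I a (s i) (s j) := by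
  refine ⟨fun ⟨t, ht⟩ => ?_, fun h => ⟨s, h⟩⟩
  rwa [Subsingleton.elim s t]

theorem not_indexLE_iff (hI : IsIsocone I) {a : selfAdjoint A} (s : Fin N ≃o spectrum ℝ (a : A))
    (i j : Fin N) : ¬ IndexLE I a i j ↔ ∃ U : Finset (Fin N), i ∈ U ∧ j ∉ U ∧ ProjMem I a s U := by
  rw [indexLE_iff s]
  constructor
  · intro h
    simp only [SpectrumLE, not_forall, not_le] at h
    obtain ⟨f, hf, hfI, hlt⟩ := h
    let U : Finset (Fin N) := Finset.univ.filter fun k => f (s i) ≤ f (s k)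
    have hjU : j ∈ Uᶜ := by simp [U, hlt]
    -- The largest value of `f` below `f (s i)`: a threshold in the gap turns `f` into the indicator
    -- of `U`.
    let u := (Uᶜ).sup' ⟨j, hjU⟩ fun k => f (s k)
    have hu : u < f (s i) := by
      refine (Finset.sup'_lt_iff _).2 fun k hk => ?_
      simpa [U] using hk
    obtain ⟨φ, hφ, hmono, h0, h1⟩ := exists_threshold hu
    refine ⟨U, by simp [U], by simpa using hjU, fun x => φ (f x), hφ.comp_continuousOn hf, ?_, ?_⟩
    · rw [← applyFun_applyFun hφ hf]
      exact hI.applyFun_mem _ hφ hmono _ hfI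
    · intro k
      split_ifs with hk
      · exact h1 _ (by simpa [U] using hk)
      · exact h0 _ (Finset.le_sup' (fun k => f (s k)) (Finset.mem_compl.2 hk))
  · rintro ⟨U, hi, hj, f, hf, hfI, hfU⟩ h
    have := h f hf hfI
    rw [hfU, hfU, if_pos hi, if_neg hj] at this
    norm_num at this

/-- For `a ∈ I` the relation `≤_a` is a partial order. -/
theorem exists_partialOrder_indexLE {a : selfAdjoint A} (ha : a ∈ I)
    (s : Fin N ≃o spectrum ℝ (a : A)) :
    ∃ P : PartialOrder (Fin N), ∀ i j, P.le i j ↔ IndexLE I a i j := by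
  refine ⟨@PartialOrder.mk _ (@Preorder.mk _ ⟨fun i j => IndexLE I a i j⟩
    ⟨fun i j => IndexLE I a i j ∧ ¬ IndexLE I a j i⟩ ?_ ?_ fun _ _ => Iff.rfl) ?_,
    fun _ _ => Iff.rfl⟩
  · intro i
    exact (indexLE_iff s i i).2 fun f _ _ => le_rfl
  · intro i j k hij hjk
    change IndexLE I a i j at hij
    change IndexLE I a j k at hjk
    change IndexLE I a i k
    rw [indexLE_iff s] at *
    exact fun f hf hfI => (hij f hf hfI).trans (hjk f hf hfI)
  · intro i j hij hji
    change IndexLE I a i j at hij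
    change IndexLE I a j i at hji
    rw [indexLE_iff s] at *
    -- Antisymmetry is where `a ∈ I` enters: the identity function separates eigenvalues.
    have h1 := hij (fun x => x) continuousOn_id (IsIsocone.applyFun_id_mem ha)
    have h2 := hji (fun x => x) continuousOn_id (IsIsocone.applyFun_id_mem ha)
    exact s.injective (Subtype.ext (le_antisymm h1 h2))

/-! ### Local constancy of `≤_a` -/

/-- Lower semicontinuity of the spectrum of self-adjoint elements. -/
theorem eventually_exists_mem_spectrum {a : selfAdjoint A} {x : ℝ} (hx : x ∈ spectrum ℝ (a : A))
    {δ : ℝ} (hδ : 0 < δ) :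
    ∀ᶠ a' : selfAdjoint A in 𝓝 a, ∃ y ∈ spectrum ℝ (a' : A), |y - x| < δ := by
  -- A tent at `x`: `χ(a) ≠ 0` is an open condition, and it forces a spectral point within `δ` of
  -- `x`.
  let χ : ℝ → ℝ := fun y => max 0 (δ - |y - x|)
  have hχ : Continuous χ := by fun_prop
  have hne : applyFun χ a ≠ 0 := by
    intro h
    have h' : cfc χ (a : A) = cfc (fun _ => (0 : ℝ)) (a : A) := by
      rw [cfc_const_zero]; exact congrArg Subtype.val h
    have := (cfc_eq_cfc_iff_eqOn (a := (a : A)) (ha := a.2) (hf := hχ.continuousOn)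
      (hg := continuousOn_const)).1 h' hx
    simp [χ] at this
    linarith
  filter_upwards [(continuous_applyFun hχ).continuousAt.eventually_ne hne] with a' ha'
  by_contra! hcon
  refine ha' (Subtype.ext ?_)
  have : cfc χ (a' : A) = cfc (fun _ => (0 : ℝ)) (a' : A) :=
    cfc_congr fun y hy => max_eq_left (by linarith [hcon y hy])
  simpa [applyFun] using this

/-- If no spectrum has more than `N` points, then spectra with `N` points vary continuously. -/
theorem eventually_exists_orderIso
    (hN : ∀ a : selfAdjoint A, (spectrum ℝ (a : A)).Finite ∧ (spectrum ℝ (a : A)).ncard ≤ N)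
    {a : selfAdjoint A} (s : Fin N ≃o spectrum ℝ (a : A)) {δ : ℝ} (hδ : 0 < δ) :
    ∀ᶠ a' : selfAdjoint A in 𝓝 a, ∃ s' : Fin N ≃o spectrum ℝ (a' : A),
      ∀ k, |(s' k : ℝ) - s k| < δ := by
  obtain ⟨η, hη, hηδ, hsep⟩ : ∃ η > 0, η ≤ δ ∧ ∀ i j, i < j → 2 * η ≤ (s j : ℝ) - s i := by
    have h : ∀ p : Fin N × Fin N, ∀ᶠ η : ℝ in 𝓝[>] 0, p.1 < p.2 → 2 * η ≤ (s p.2 : ℝ) - s p.1 := by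
      rintro ⟨i, j⟩
      by_cases hij : i < j
      · have hpos : 0 < (s j : ℝ) - s i := sub_pos.2 (s.strictMono hij)
        have : ∀ᶠ η : ℝ in 𝓝 0, η < ((s j : ℝ) - s i) / 2 := eventually_lt_nhds (by linarith)
        filter_upwards [this.filter_mono nhdsWithin_le_nhds] with η hη _
        linarith
      · simp [hij]
    have h2 : ∀ᶠ η : ℝ in 𝓝[>] 0, η < δ :=
      (eventually_lt_nhds hδ).filter_mono nhdsWithin_le_nhds
    obtain ⟨η, ⟨h1, h2⟩, h3⟩ := (((eventually_all.2 h).and h2).and self_mem_nhdsWithin).exists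
    exact ⟨η, h3, h2.le, fun i j hij => h1 (i, j) hij⟩
  have := eventually_all.2 fun k => eventually_exists_mem_spectrum (s k).2 hη
  filter_upwards [this] with a' ha'
  choose t ht hts using ha'
  have hmono : StrictMono fun k => (⟨t k, ht k⟩ : spectrum ℝ (a' : A)) := by
    intro i j hij
    have h1 := abs_lt.1 (hts i)
    have h2 := abs_lt.1 (hts j)
    have h3 := hsep i j hij
    change t i < t j
    linarith
  -- The `N` distinct points found exhaust the spectrum, by the cardinality bound.
  have := (hN a').1.fintype
  have hcard : Fintype.card (spectrum ℝ (a' : A)) ≤ Fintype.card (Fin N) := by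
    rw [Fintype.card_fin, ← Nat.card_eq_fintype_card]
    exact (hN a').2
  have hsurj := ((Fintype.bijective_iff_injective_and_card _).2 ⟨hmono.injective,
    le_antisymm (Fintype.card_le_of_injective _ hmono.injective) hcard⟩).2
  exact ⟨hmono.orderIsoOfSurjective _ hsurj, fun k => (hts k).trans_le hηδ⟩

/-- A continuous function which is locally constant, equal to the indicator of `U`, around finitely
many points. -/
theorem exists_locally_indicator (s : Fin N → ℝ) (hs : Function.Injective s) (U : Finset (Fin N)) :
    ∃ χ : ℝ → ℝ, Continuous χ ∧ ∃ δ > 0, δ ≤ 1 ∧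
      ∀ k, ∀ x, |x - s k| < δ → χ x = if k ∈ U then 1 else 0 := by
  have hfin : (s '' (U : Set (Fin N))ᶜ).Finite := Set.toFinite _
  have hfin' : (s '' (U : Set (Fin N))).Finite := Set.toFinite _
  have hdisj : Disjoint (s '' (U : Set (Fin N))ᶜ) (s '' (U : Set (Fin N))) :=
    (Set.disjoint_image_iff hs).2 disjoint_compl_left
  obtain ⟨δ, hδ, hd⟩ := hdisj.exists_cthickenings hfin.isCompact hfin'.isClosed
  obtain ⟨χ, h0, h1, -⟩ := exists_continuous_zero_one_of_isClosed
    (Metric.isClosed_cthickening) (Metric.isClosed_cthickening) hd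
  refine ⟨χ, χ.continuous, min δ 1, by positivity, min_le_right _ _, fun k x hx => ?_⟩
  have hx' : dist x (s k) ≤ δ := by
    rw [Real.dist_eq]; exact (hx.trans_le (min_le_left _ _)).le
  split_ifs with hk
  · exact h1 (Metric.mem_cthickening_of_dist_le x (s k) δ _ ⟨k, hk, rfl⟩ hx')
  · exact h0 (Metric.mem_cthickening_of_dist_le x (s k) δ _ ⟨k, hk, rfl⟩ hx')

/-- On the interior of `I`, membership in `I` of the spectral projection on `U` is locally constant
in `a`. -/
theorem exists_eventually_projMem_iff (hI : IsIsocone I) {a : selfAdjoint A} (ha : a ∈ interior I)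
    (s : Fin N ≃o spectrum ℝ (a : A)) (U : Finset (Fin N)) :
    ∃ δ > 0, ∀ᶠ a' : selfAdjoint A in 𝓝 a, ∀ s' : Fin N ≃o spectrum ℝ (a' : A),
      (∀ k, |(s' k : ℝ) - s k| < δ) → (ProjMem I a' s' U ↔ ProjMem I a s U) := by
  obtain ⟨χ, hχ, δ, hδ, hδ1, hχU⟩ := exists_locally_indicator (fun k => (s k : ℝ))
    (Subtype.val_injective.comp s.injective) U
  refine ⟨δ, hδ, ?_⟩
  have hs : ∀ k, χ (s k) = if k ∈ U then 1 else 0 := fun k => hχU k _ (by simpa using hδ)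
  rw [projMem_iff hχ hs]
  by_cases hmem : applyFun χ a ∈ I
  · obtain ⟨C, hC⟩ : ∃ C : ℝ, ∀ k, |(s k : ℝ)| ≤ C := by
      obtain ⟨C, hC⟩ := (Set.finite_range fun k => |(s k : ℝ)|).bddAbove
      exact ⟨C, fun k => hC ⟨k, rfl⟩⟩
    -- Nearby eigenvalues are at most `|C| + 1` in absolute value (as `δ ≤ 1`), so `εx` perturbs the
    -- indicator by at most `1/3`; hence the thresholds `1/3` and `2/3`.
    let ε : ℝ := 1 / (3 * (|C| + 1))
    have hC1 : 0 < |C| + 1 := by positivity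
    have hε : 0 < ε := by positivity
    have hεC : ε * (|C| + 1) = 1 / 3 := by
      simp only [ε]; field_simp
    have hg : Continuous fun x => χ x + ε * x := by fun_prop
    have hint : applyFun (fun x => χ x + ε * x) a ∈ interior I := by
      rw [applyFun_add_const_mul ε a hχ.continuousOn]
      exact hI.add_smul_mem_interior hε ha hmem
    filter_upwards [(continuous_applyFun hg).continuousAt.eventually
      (isOpen_interior.mem_nhds hint)] with a' ha' s' hs'
    obtain ⟨φ, hφ, hmono, h0, h1⟩ := exists_threshold (u := 1 / 3) (v := 2 / 3) (by norm_num)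
    refine iff_of_true ⟨fun x => φ (χ x + ε * x), (hφ.comp hg).continuousOn, ?_, fun k => ?_⟩ hmem
    · rw [← applyFun_applyFun hφ hg.continuousOn]
      exact hI.applyFun_mem _ hφ hmono _ (interior_subset ha')
    · have hb : |(s' k : ℝ)| ≤ |C| + 1 := by
        have e1 := abs_sub_abs_le_abs_sub (s' k : ℝ) (s k)
        have e2 := hs' k
        have e3 := hC k
        have e4 := le_abs_self C
        linarith
      have hb' : |ε * (s' k : ℝ)| ≤ 1 / 3 := by
        rw [abs_mul, abs_of_pos hε, ← hεC]
        gcongr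
      have hb'' := abs_le.1 hb'
      have hk' := hχU k _ (hs' k)
      beta_reduce
      split_ifs at hk' ⊢ with hk
      · exact h1 _ (by linarith)
      · exact h0 _ (by linarith)
  · filter_upwards [(continuous_applyFun hχ).continuousAt.eventually
      (hI.isClosed.isOpen_compl.mem_nhds hmem)] with a' ha' s' hs'
    rw [projMem_iff hχ fun k => hχU k _ (hs' k)]
    exact iff_of_false ha' hmem

theorem nonempty_orderIso_iff {S : Set ℝ} (hS : S.Finite) : Nonempty (Fin N ≃o S) ↔ S.ncard = N := by
  constructor
  · rintro ⟨s⟩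
    simpa using (Nat.card_congr s.toEquiv).symm
  · intro h
    have := hS.fintype
    exact ⟨Fintype.orderIsoFinOfCardEq S (by rw [← Nat.card_eq_fintype_card]; exact h)⟩

theorem eventually_indexLE_iff (hI : IsIsocone I)
    (hN : ∀ a : selfAdjoint A, (spectrum ℝ (a : A)).Finite ∧ (spectrum ℝ (a : A)).ncard ≤ N)
    {a : selfAdjoint A} (ha : a ∈ interior I) (haN : (spectrum ℝ (a : A)).ncard = N) :
    ∀ᶠ a' : selfAdjoint A in 𝓝 a, a' ∈ interior I ∧ (spectrum ℝ (a' : A)).ncard = N ∧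
      ∀ i j : Fin N, IndexLE I a' i j ↔ IndexLE I a i j := by
  obtain ⟨s⟩ := (nonempty_orderIso_iff (hN a).1).2 haN
  choose δ hδ hev using exists_eventually_projMem_iff hI ha s
  obtain ⟨η, hη, hηδ⟩ : ∃ η > 0, ∀ U, η ≤ δ U := by
    refine ⟨Finset.univ.inf' Finset.univ_nonempty δ, ?_, fun U => Finset.inf'_le _ (Finset.mem_univ U)⟩
    exact (Finset.lt_inf'_iff _).2 fun U _ => hδ U
  filter_upwards [isOpen_interior.mem_nhds ha, eventually_exists_orderIso hN s hη,
    eventually_all.2 hev] with a' h1 h2 h3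
  obtain ⟨s', hs'⟩ := h2
  refine ⟨h1, (nonempty_orderIso_iff (hN a').1).1 ⟨s'⟩, fun i j => ?_⟩
  rw [← not_iff_not, not_indexLE_iff hI s', not_indexLE_iff hI s]
  exact exists_congr fun U => and_congr_right fun _ => and_congr_right fun _ =>
    h3 U s' fun k => (hs' k).trans_le (hηδ U)

end Generic

/-! ### Simple eigenvalues as maximal spectrum -/

section SimpleSpectrum

variable {ι : Type*} [Fintype ι] [DecidableEq ι] {M : Matrix ι ι ℂ}

theorem Matrix.IsHermitian.finite_spectrum_real (hM : M.IsHermitian) : (spectrum ℝ M).Finite := by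
  rw [hM.spectrum_real_eq_range_eigenvalues]
  exact Set.finite_range _

theorem Matrix.IsHermitian.ncard_spectrum_real_le (hM : M.IsHermitian) :
    (spectrum ℝ M).ncard ≤ Fintype.card ι := by
  rw [hM.spectrum_real_eq_range_eigenvalues, ← Set.image_univ]
  refine (Set.ncard_image_le Set.finite_univ).trans ?_
  rw [Set.ncard_univ, Nat.card_eq_fintype_card]

theorem Matrix.IsHermitian.nonDerogatory_iff_injective (hM : M.IsHermitian) :
    NonDerogatory M ↔ Function.Injective hM.eigenvalues := by
  rw [NonDerogatory, hM.roots_charpoly_eq_eigenvalues,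
    Multiset.nodup_map_iff_inj_on (Finset.univ.nodup)]
  simp [Function.Injective]

theorem Matrix.IsHermitian.nonDerogatory_iff_ncard (hM : M.IsHermitian) :
    NonDerogatory M ↔ (spectrum ℝ M).ncard = Fintype.card ι := by
  rw [hM.nonDerogatory_iff_injective, hM.spectrum_real_eq_range_eigenvalues, ← Set.image_univ,
    ← Nat.card_eq_fintype_card, ← Set.ncard_univ, Set.ncard_image_iff Set.finite_univ,
    Set.injOn_univ]

end SimpleSpectrum

/-! ### Block-diagonal matrices -/

section Block

variable {k : ℕ} {n : Fin k → ℕ}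

theorem isHermitian_blockDiagonal' (a : selfAdjoint (BlockAlgebra n)) :
    (Matrix.blockDiagonal' (a : BlockAlgebra n)).IsHermitian := by
  have h : star (a : BlockAlgebra n) = a := a.2
  rw [Matrix.IsHermitian, Matrix.blockDiagonal'_conjTranspose]
  exact congrArg Matrix.blockDiagonal' h

theorem isUnit_blockDiagonal'_iff (a : BlockAlgebra n) :
    IsUnit (Matrix.blockDiagonal' a) ↔ IsUnit a := by
  constructor
  -- The diagonal blocks of an inverse are right inverses of the blocks, which suffices for square
  -- matrices.
  · rintro ⟨⟨_, B, hB, -⟩, rfl⟩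
    refine Pi.isUnit_iff.2 fun x => IsUnit.of_mul_eq_one (Matrix.blockDiag' B x) ?_
    ext i j
    have := congrFun (congrFun hB ⟨x, i⟩) ⟨x, j⟩
    rw [Matrix.mul_apply, Fintype.sum_sigma, Finset.sum_eq_single x] at this
    · simpa [Matrix.mul_apply, Matrix.blockDiag'_apply, Matrix.one_apply] using this
    · intro y _ hy
      refine Finset.sum_eq_zero fun l _ => ?_
      rw [Matrix.blockDiagonal'_apply_ne _ _ _ hy.symm, zero_mul]
    · simp
  · exact fun h => h.map (Matrix.blockDiagonal'RingHom (fun x => Fin (n x)) ℂ)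

theorem spectrum_blockDiagonal' (a : BlockAlgebra n) :
    spectrum ℝ (Matrix.blockDiagonal' a) = spectrum ℝ a := by
  ext x
  have h : algebraMap ℝ (Matrix (Σ x, Fin (n x)) (Σ x, Fin (n x)) ℂ) x - Matrix.blockDiagonal' a =
      Matrix.blockDiagonal' (algebraMap ℝ (BlockAlgebra n) x - a) := by
    rw [Matrix.blockDiagonal'_sub]
    congr 1
    rw [Algebra.algebraMap_eq_smul_one, Algebra.algebraMap_eq_smul_one, Matrix.blockDiagonal'_smul,
      Matrix.blockDiagonal'_one]
  rw [spectrum.mem_iff, spectrum.mem_iff, h, isUnit_blockDiagonal'_iff]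

theorem finite_spectrum_blockAlgebra (a : selfAdjoint (BlockAlgebra n)) :
    (spectrum ℝ (a : BlockAlgebra n)).Finite ∧
      (spectrum ℝ (a : BlockAlgebra n)).ncard ≤ ∑ x, n x := by
  rw [← spectrum_blockDiagonal']
  refine ⟨(isHermitian_blockDiagonal' a).finite_spectrum_real, ?_⟩
  simpa using (isHermitian_blockDiagonal' a).ncard_spectrum_real_le

theorem nonDerogatory_blockDiagonal'_iff (a : selfAdjoint (BlockAlgebra n)) :
    NonDerogatory (Matrix.blockDiagonal' (a : BlockAlgebra n)) ↔
      (spectrum ℝ (a : BlockAlgebra n)).ncard = ∑ x, n x := by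
  rw [(isHermitian_blockDiagonal' a).nonDerogatory_iff_ncard, spectrum_blockDiagonal']
  simp

end Block

/-! ### Avoiding derogatory matrices -/

section GenericPosition

variable {N : ℕ}

local notation "Mat" N => Matrix (Fin N) (Fin N) ℂ

instance finiteDimensional_selfAdjoint_matrix : FiniteDimensional ℝ (selfAdjoint (Mat N)) :=
  FiniteDimensional.of_injective
    ({ toFun := fun a => (a : Mat N), map_add' := fun _ _ => rfl, map_smul' := fun _ _ => rfl } :
      selfAdjoint (Mat N) →ₗ[ℝ] Mat N) Subtype.val_injective

/-- The projection killing the basis vectors `i` and `j`. -/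
noncomputable def coProj (i j : Fin N) : Mat N :=
  Matrix.diagonal fun r => if r = i ∨ r = j then 0 else 1

/-- A polynomial parametrization of Hermitian matrices with kernel of dimension at least two. -/
noncomputable def doubleKernel (i j : Fin N) (H : Mat N) : Mat N :=
  star (1 - coProj i j * H * (1 - coProj i j)) * (coProj i j * H * coProj i j) *
    (1 - coProj i j * H * (1 - coProj i j))

theorem isSelfAdjoint_coProj (i j : Fin N) : IsSelfAdjoint (coProj i j) := by
  rw [IsSelfAdjoint, coProj, Matrix.star_eq_conjTranspose, Matrix.diagonal_conjTranspose]
  congr 1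
  ext r
  simp only [Pi.star_apply]
  split_ifs <;> simp

theorem isSelfAdjoint_doubleKernel (i j : Fin N) {H : Mat N} (hH : IsSelfAdjoint H) :
    IsSelfAdjoint (doubleKernel i j H) := by
  have hQ := (isSelfAdjoint_coProj i j).star_eq
  rw [IsSelfAdjoint, doubleKernel]
  simp only [star_mul, star_star, hQ, hH.star_eq, mul_assoc]

/-- Hermitian matrices with vanishing `(i, j)` entry. -/
noncomputable def vanishingEntry (i j : Fin N) : Submodule ℝ (selfAdjoint (Mat N)) where
  carrier := {H | (H : Mat N) i j = 0}
  zero_mem' := rfl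
  add_mem' {a b} ha hb := by
    have : (a : Mat N) i j + (b : Mat N) i j = 0 := by rw [ha, hb, add_zero]
    exact this
  smul_mem' r a ha := by
    have : r • (a : Mat N) i j = 0 := by rw [ha, smul_zero]
    exact this

theorem finrank_vanishingEntry_lt {i j : Fin N} (hij : i ≠ j) :
    finrank ℝ (vanishingEntry i j) < finrank ℝ (selfAdjoint (Mat N)) := by
  refine Submodule.finrank_lt fun h => ?_
  have hE : IsSelfAdjoint (Matrix.single i j (1 : ℂ) + star (Matrix.single i j (1 : ℂ))) :=
    IsSelfAdjoint.add_star_self _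
  have : (⟨_, hE⟩ : selfAdjoint (Mat N)) ∈ vanishingEntry i j := h ▸ Submodule.mem_top
  change (Matrix.single i j (1 : ℂ) + star (Matrix.single i j (1 : ℂ))) i j = 0 at this
  simp [Matrix.star_eq_conjTranspose, hij, hij.symm] at this

/-- Hermitian matrices on lines joining `x` to a derogatory matrix are values of this map on
`vanishingEntry i j`. -/
noncomputable def coneMap (x : selfAdjoint (Mat N)) (i j : Fin N) (H : selfAdjoint (Mat N)) :
    selfAdjoint (Mat N) :=
  x + ((H : Mat N) i i).re • (((H : Mat N) j j).re • (1 : selfAdjoint (Mat N)) +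
    ⟨doubleKernel i j H, isSelfAdjoint_doubleKernel i j H.2⟩ - x)

theorem contDiff_coneMap (x : selfAdjoint (Mat N)) (i j : Fin N) :
    ContDiff ℝ 1 (coneMap x i j) := by
  let val : selfAdjoint (Mat N) →L[ℝ] Mat N := LinearMap.toContinuousLinearMap
    { toFun := fun a => (a : Mat N), map_add' := fun _ _ => rfl, map_smul' := fun _ _ => rfl }
  let entry (i : Fin N) : selfAdjoint (Mat N) →L[ℝ] ℝ := LinearMap.toContinuousLinearMap
    { toFun := fun a => ((a : Mat N) i i).re, map_add' := fun _ _ => rfl,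
      map_smul' := fun r a => by
        change (r • (a : Mat N) i i).re = r * ((a : Mat N) i i).re
        simp }
  let part : (Mat N) →L[ℝ] selfAdjoint (Mat N) :=
    LinearMap.toContinuousLinearMap (selfAdjointPart ℝ)
  have hval : ContDiff ℝ 1 fun H : selfAdjoint (Mat N) => (H : Mat N) := val.contDiff
  have hentry (i : Fin N) : ContDiff ℝ 1 fun H : selfAdjoint (Mat N) => ((H : Mat N) i i).re :=
    (entry i).contDiff
  have hT : ContDiff ℝ 1 fun H : selfAdjoint (Mat N) =>
      1 - coProj i j * (H : Mat N) * (1 - coProj i j) :=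
    contDiff_const.sub ((contDiff_const.mul hval).mul contDiff_const)
  have hD : ContDiff ℝ 1 fun H : selfAdjoint (Mat N) => doubleKernel i j (H : Mat N) :=
    (((starL' ℝ : (Mat N) ≃L[ℝ] Mat N).contDiff.comp hT).mul
      ((contDiff_const.mul hval).mul contDiff_const)).mul hT
  have hP : ContDiff ℝ 1 fun H : selfAdjoint (Mat N) =>
      (⟨doubleKernel i j H, isSelfAdjoint_doubleKernel i j H.2⟩ : selfAdjoint (Mat N)) := by
    convert part.contDiff.comp hD using 2 with H
    exact ((isSelfAdjoint_doubleKernel i j H.2).selfAdjointPart_apply ℝ).symm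
  exact contDiff_const.add ((hentry i).smul ((((hentry j).smul contDiff_const).add hP).sub
    contDiff_const))

/-- Gaussian elimination in the plane spanned by `u` and `v`, with pivots `i` and `j`. -/
theorem exists_normalized_pair {u v : Fin N → ℂ} (huv : LinearIndependent ℂ ![u, v])
    {K : Mat N} (hu : K.mulVec u = 0) (hv : K.mulVec v = 0) :
    ∃ i j : Fin N, i ≠ j ∧ ∃ u' v' : Fin N → ℂ, K.mulVec u' = 0 ∧ K.mulVec v' = 0 ∧
      u' i = 1 ∧ u' j = 0 ∧ v' i = 0 ∧ v' j = 1 := by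
  rw [LinearIndependent.pair_iff] at huv
  have hu0 : u ≠ 0 := by
    rintro rfl
    simpa using huv 1 0
  obtain ⟨i, hi⟩ := Function.ne_iff.1 hu0
  have hi : u i ≠ 0 := hi
  have hw0 : v - (v i / u i) • u ≠ 0 := by
    intro h
    have := (huv (-(v i / u i)) 1 (by rw [← h, neg_smul, one_smul]; abel)).2
    exact one_ne_zero this
  set w := v - (v i / u i) • u with hw
  have hKw : K.mulVec w = 0 := by
    rw [hw, Matrix.mulVec_sub, Matrix.mulVec_smul, hu, hv, smul_zero, sub_zero]
  have hwi : w i = 0 := by simp [hw, hi]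
  obtain ⟨j, hj⟩ := Function.ne_iff.1 hw0
  have hj : w j ≠ 0 := hj
  refine ⟨i, j, fun h => hj (h ▸ hwi), (u i)⁻¹ • (u - (u j / w j) • w), (w j)⁻¹ • w, ?_, ?_, ?_, ?_,
    ?_, ?_⟩
  · rw [Matrix.mulVec_smul, Matrix.mulVec_sub, Matrix.mulVec_smul, hu, hKw, smul_zero, sub_zero,
      smul_zero]
  · rw [Matrix.mulVec_smul, hKw, smul_zero]
  · simp [hwi, hi]
  · simp [hj]
  · simp [hwi]
  · simp [hj]

/-- Put the normalized kernel vectors in columns `i`, `j` of `1 + C`. The congruence `B` of `K` by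
`1 + C` vanishes on rows and columns `i`, `j`, so one Hermitian `H` stores `B`, `C` and the two
diagonal numbers in disjoint places, leaving the `(i, j)` entry zero. Since `C * C = 0`, `1 - C`
undoes the congruence. -/
theorem exists_doubleKernel_eq {K : Mat N} (hK : IsSelfAdjoint K) {u v : Fin N → ℂ}
    (huv : LinearIndependent ℂ ![u, v]) (hu : K.mulVec u = 0) (hv : K.mulVec v = 0) (α β : ℝ) :
    ∃ i j : Fin N, i ≠ j ∧ ∃ H ∈ vanishingEntry i j, doubleKernel i j (H : Mat N) = K ∧
      ((H : Mat N) i i).re = α ∧ ((H : Mat N) j j).re = β := by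
  obtain ⟨i, j, hij, u, v, hu, hv, hui, huj, hvi, hvj⟩ := exists_normalized_pair huv hu hv
  let Q : Mat N := coProj i j
  let C : Mat N := Matrix.of fun r c =>
    if r = i ∨ r = j then 0 else if c = i then u r else if c = j then v r else 0
  let D : Mat N := Matrix.diagonal fun r => if r = i then (α : ℂ) else if r = j then (β : ℂ) else 0
  let B : Mat N := star (1 + C) * K * (1 + C)
  have hQ : IsSelfAdjoint Q := isSelfAdjoint_coProj i j
  have hD : IsSelfAdjoint D := by
    rw [IsSelfAdjoint, Matrix.star_eq_conjTranspose, Matrix.diagonal_conjTranspose]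
    congr 1
    ext r
    simp only [Pi.star_apply]
    split_ifs <;> simp
  have hB : IsSelfAdjoint B := by
    simp only [IsSelfAdjoint, B, star_mul, star_star, hK.star_eq, mul_assoc]
  have hQC : Q * C = C := by
    ext r c
    simp only [Q, coProj, Matrix.diagonal_mul, C, Matrix.of_apply]
    split_ifs <;> simp
  have hCQ : C * Q = 0 := by
    ext r c
    simp only [Q, coProj, Matrix.mul_diagonal, C, Matrix.of_apply, Matrix.zero_apply]
    split_ifs <;> simp_all
  have hQD : Q * D = 0 := by
    ext r c
    simp only [Q, coProj, Matrix.diagonal_mul, D, Matrix.diagonal_apply, Matrix.zero_apply]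
    split_ifs <;> simp_all
  have hKT : K * (1 + C) * Q = K * (1 + C) := by
    have hcol (c : Fin N) (w : Fin N → ℂ) (h : ∀ r, (1 + C) r c = w r) (hw : K.mulVec w = 0)
        (r : Fin N) : (K * (1 + C)) r c = 0 := by
      rw [Matrix.mul_apply]
      simp only [h]
      exact congrFun hw r
    have hci := hcol i u (fun r => by
      simp only [C, Matrix.add_apply, Matrix.one_apply, Matrix.of_apply]
      split_ifs <;> simp_all) hu
    have hcj := hcol j v (fun r => by
      simp only [C, Matrix.add_apply, Matrix.one_apply, Matrix.of_apply]
      split_ifs <;> simp_all) hv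
    ext r c
    simp only [Q, coProj, Matrix.mul_diagonal]
    split_ifs with h
    · rcases h with rfl | rfl
      · rw [hci, zero_mul]
      · rw [hcj, zero_mul]
    · rw [mul_one]
  have hBQ : B * Q = B := by
    simp only [B, mul_assoc] at hKT ⊢
    rw [hKT]
  have hQB : Q * B = B := by simpa [hQ.star_eq, hB.star_eq] using congrArg star hBQ
  have hQCs : Q * star C = 0 := by simpa [hQ.star_eq] using congrArg star hCQ
  have hCC : C * C = 0 := by
    rw [← hQC, ← mul_assoc, mul_assoc Q C Q, hCQ, mul_zero, zero_mul]
  have hH : IsSelfAdjoint (B + (C + star C) + D) := (hB.add (.add_star_self C)).add hD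
  have hQH : Q * (B + (C + star C) + D) = B + C := by
    simp only [mul_add, hQB, hQC, hQCs, hQD, add_zero]
  have hT : (1 + C) * (1 - C) = 1 := by
    rw [mul_sub, mul_one, add_mul, one_mul, hCC]; abel
  have hBrow (c : Fin N) (r : Fin N) (hr : r = i ∨ r = j) : B r c = 0 := by
    rw [← hQB]
    simp only [Q, coProj, Matrix.diagonal_mul, if_pos hr, zero_mul]
  have hCrow (c : Fin N) (r : Fin N) (hr : r = i ∨ r = j) : C r c = 0 := by
    simp only [C, Matrix.of_apply, if_pos hr]
  have hentry (r c : Fin N) (hr : r = i ∨ r = j) (hc : c = i ∨ c = j) :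
      (B + (C + star C) + D) r c = D r c := by
    simp only [Matrix.add_apply, Matrix.star_apply, hBrow c r hr, hCrow c r hr, hCrow r c hc,
      star_zero, zero_add]
  refine ⟨i, j, hij, ⟨_, hH⟩, ?_, ?_, ?_, ?_⟩
  · refine (hentry i j (.inl rfl) (.inr rfl)).trans ?_
    exact Matrix.diagonal_apply_ne _ hij
  · change star (1 - Q * (B + (C + star C) + D) * (1 - Q)) *
      (Q * (B + (C + star C) + D) * Q) * (1 - Q * (B + (C + star C) + D) * (1 - Q)) = K
    have e1 : (B + C) * (1 - Q) = C := by
      rw [mul_sub, mul_one, add_mul, hBQ, hCQ]; abel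
    have e2 : (B + C) * Q = B := by rw [add_mul, hBQ, hCQ, add_zero]
    rw [hQH, e1, e2]
    calc star (1 - C) * B * (1 - C) = star ((1 + C) * (1 - C)) * K * ((1 + C) * (1 - C)) := by
          simp only [B, star_mul, mul_assoc]
      _ = K := by rw [hT, star_one, one_mul, mul_one]
  · refine (congrArg Complex.re (hentry i i (.inl rfl) (.inl rfl))).trans ?_
    simp [D]
  · refine (congrArg Complex.re (hentry j j (.inr rfl) (.inr rfl))).trans ?_
    simp [D, hij.symm]

theorem exists_coneMap_eq {x z : selfAdjoint (Mat N)} {t : ℝ} (ht : t ≠ 0)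
    (h : ¬ NonDerogatory ((x + t • (z - x) : selfAdjoint (Mat N)) : Mat N)) :
    ∃ i j : Fin N, i ≠ j ∧ ∃ H : vanishingEntry i j, coneMap x i j H = z := by
  set y : selfAdjoint (Mat N) := x + t • (z - x) with hy
  have hH : (y : Mat N).IsHermitian := y.2
  rw [hH.nonDerogatory_iff_injective] at h
  simp only [Function.Injective, not_forall] at h
  obtain ⟨p, q, hpq, hne⟩ := h
  set l := hH.eigenvalues p
  have hK : IsSelfAdjoint ((y : Mat N) - l • (1 : Mat N)) := y.2.sub ((IsSelfAdjoint.all l).smul (.one _))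
  have hker (q : Fin N) (hq : hH.eigenvalues q = l) :
      ((y : Mat N) - l • (1 : Mat N)).mulVec (hH.eigenvectorBasis q) = 0 := by
    rw [Matrix.sub_mulVec, hH.mulVec_eigenvectorBasis, hq, Matrix.smul_mulVec, Matrix.one_mulVec,
      sub_self]
  have hli : LinearIndependent ℂ
      ![(hH.eigenvectorBasis p : Fin N → ℂ), (hH.eigenvectorBasis q : Fin N → ℂ)] := by
    rw [LinearIndependent.pair_iff]
    intro c d hcd
    exact (LinearIndepOn.pair_iff _ hne).1
      (hH.eigenvectorBasis.orthonormal.linearIndependent.linearIndepOn _) c d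
      (WithLp.ofLp_injective 2 hcd)
  -- The diagonal slots carry `t⁻¹` and the double eigenvalue `l`, because `z = x + t⁻¹(y - x)`.
  obtain ⟨i, j, hij, H, hHm, hHK, h1, h2⟩ := exists_doubleKernel_eq hK
    hli (hker p rfl) (hker q hpq.symm) t⁻¹ l
  · refine ⟨i, j, hij, ⟨H, hHm⟩, ?_⟩
    have e : l • (1 : selfAdjoint (Mat N)) +
        ⟨doubleKernel i j H, isSelfAdjoint_doubleKernel i j H.2⟩ = y := by
      refine Subtype.ext ?_
      change l • (1 : Mat N) + doubleKernel i j (H : Mat N) = y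
      rw [hHK]; abel
    rw [coneMap, h1, h2, e, hy, add_sub_cancel_left, smul_smul, inv_mul_cancel₀ ht, one_smul]
    abel

/-- For generic `z`, no point of the line joining `x` to `z`, except possibly `x`, is derogatory. -/
theorem dense_nonDerogatory_cone (x y : selfAdjoint (Mat N)) :
    Dense {z : selfAdjoint (Mat N) | ∀ t : ℝ, t ≠ 0 →
      NonDerogatory ((x + t • (z - x) : selfAdjoint (Mat N)) : Mat N) ∧
      NonDerogatory ((y + t • (z - y) : selfAdjoint (Mat N)) : Mat N)} := by
  let S (x : selfAdjoint (Mat N)) : Set (selfAdjoint (Mat N)) :=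
    ⋃ p : {p : Fin N × Fin N // p.1 ≠ p.2},
      Set.range fun H : vanishingEntry p.1.1 p.1.2 => coneMap x p.1.1 p.1.2 H
  have hS (x z : selfAdjoint (Mat N)) (hz : z ∉ S x) (t : ℝ) (ht : t ≠ 0) :
      NonDerogatory ((x + t • (z - x) : selfAdjoint (Mat N)) : Mat N) := by
    by_contra h
    obtain ⟨i, j, hij, H, hH⟩ := exists_coneMap_eq ht h
    exact hz (Set.mem_iUnion.2 ⟨⟨(i, j), hij⟩, H, hH⟩)
  have hsub : (S x ∪ S y)ᶜ ⊆ {z : selfAdjoint (Mat N) | ∀ t : ℝ, t ≠ 0 →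
      NonDerogatory ((x + t • (z - x) : selfAdjoint (Mat N)) : Mat N) ∧
      NonDerogatory ((y + t • (z - y) : selfAdjoint (Mat N)) : Mat N)} := by
    intro z hz t ht
    simp only [Set.compl_union, Set.mem_inter_iff, Set.mem_compl_iff] at hz
    exact ⟨hS x z hz.1 t ht, hS y z hz.2 t ht⟩
  refine Dense.mono hsub ?_
  rcases isEmpty_or_nonempty {p : Fin N × Fin N // p.1 ≠ p.2} with hE | ⟨⟨p, hp⟩⟩
  · simp [S, Set.iUnion_of_empty]
  · have hd : finrank ℝ (selfAdjoint (Mat N)) - 1 < finrank ℝ (selfAdjoint (Mat N)) :=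
      Nat.sub_lt ((Nat.zero_le _).trans_lt (finrank_vanishingEntry_lt hp)) one_pos
    have hdim (x : selfAdjoint (Mat N)) :
        dimH (S x) ≤ (finrank ℝ (selfAdjoint (Mat N)) - 1 : ℕ) := by
      rw [dimH_iUnion]
      refine iSup_le fun p => ?_
      let e := (finBasis ℝ (vanishingEntry p.1.1 p.1.2)).equivFun
      let incl : (Fin (finrank ℝ (vanishingEntry p.1.1 p.1.2)) → ℝ) →L[ℝ] selfAdjoint (Mat N) :=
        LinearMap.toContinuousLinearMap
          ((vanishingEntry p.1.1 p.1.2).subtype.comp e.symm.toLinearMap)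
      have hrange : (Set.range fun H : vanishingEntry p.1.1 p.1.2 => coneMap x p.1.1 p.1.2 H) =
          Set.range (coneMap x p.1.1 p.1.2 ∘ incl) :=
        (e.symm.surjective.range_comp fun H => coneMap x p.1.1 p.1.2 H).symm
      rw [hrange]
      -- A `C¹` image has Hausdorff dimension at most that of its source, here a proper subspace.
      refine ((contDiff_coneMap x p.1.1 p.1.2).comp incl.contDiff).dimH_range_le.trans ?_
      rw [finrank_fin_fun]
      exact_mod_cast Nat.le_sub_one_of_lt (finrank_vanishingEntry_lt p.2)
    refine dense_compl_of_dimH_lt_finrank ?_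
    rw [dimH_union]
    exact (max_le (hdim x) (hdim y)).trans_lt (by exact_mod_cast hd)

/-- Two non-derogatory elements of a convex open set are joined by two segments of non-derogatory
elements of this set. -/
theorem eq_of_locally_constant_nonDerogatory {U : Set (selfAdjoint (Mat N))} (hU : IsOpen U)
    (hUc : Convex ℝ U) {β : Type*} (F : selfAdjoint (Mat N) → β)
    (hF : ∀ a ∈ U, NonDerogatory (a : Mat N) → ∀ᶠ a' in 𝓝 a, F a' = F a)
    {x y : selfAdjoint (Mat N)} (hx : x ∈ U) (hy : y ∈ U) (hxN : NonDerogatory (x : Mat N))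
    (hyN : NonDerogatory (y : Mat N)) : F x = F y := by
  obtain ⟨z, hzU, hz⟩ := (dense_nonDerogatory_cone x y).inter_open_nonempty U hU ⟨x, hx⟩
  have key (x : selfAdjoint (Mat N)) (hx : x ∈ U) (hxN : NonDerogatory (x : Mat N))
      (h : ∀ t : ℝ, t ≠ 0 →
        NonDerogatory ((x + t • (z - x) : selfAdjoint (Mat N)) : Mat N)) : F x = F z := by
    have hseg : ∀ a ∈ segment ℝ x z, a ∈ U ∧ NonDerogatory (a : Mat N) := by
      intro a ha
      refine ⟨hUc.segment_subset hx hzU ha, ?_⟩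
      rw [segment_eq_image'] at ha
      obtain ⟨t, -, rfl⟩ := ha
      by_cases ht : t = 0
      · simpa [ht] using hxN
      · exact h t ht
    -- With the discrete topology, local constancy is continuity, and segments are connected.
    let _ : TopologicalSpace β := ⊥
    have : DiscreteTopology β := ⟨rfl⟩
    refine (convex_segment x z).isPreconnected.constant (fun a ha => ?_)
      (left_mem_segment ℝ x z) (right_mem_segment ℝ x z)
    obtain ⟨h1, h2⟩ := hseg a ha
    have : Tendsto F (𝓝 a) (𝓝 (F a)) :=
      tendsto_const_nhds.congr' ((hF a h1 h2).mono fun _ h => h.symm)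
    exact this.mono_left nhdsWithin_le_nhds
  rw [key x hx hxN fun t ht => (hz t ht).1, key y hy hyN fun t ht => (hz t ht).2]

theorem exists_nonDerogatory_mem {U : Set (selfAdjoint (Mat N))} (hU : IsOpen U)
    (hne : U.Nonempty) : ∃ a ∈ U, NonDerogatory (a : Mat N) := by
  obtain ⟨z, hzU, hz⟩ := (dense_nonDerogatory_cone 0 0).inter_open_nonempty U hU hne
  exact ⟨z, hzU, by simpa using (hz 1 one_ne_zero).1⟩

end GenericPosition

/-! ### The full matrix algebra and the theorem -/

theorem finite_spectrum_matrix {N : ℕ} (a : selfAdjoint (Matrix (Fin N) (Fin N) ℂ)) :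
    (spectrum ℝ (a : Matrix (Fin N) (Fin N) ℂ)).Finite ∧
      (spectrum ℝ (a : Matrix (Fin N) (Fin N) ℂ)).ncard ≤ N := by
  have ha : (a : Matrix (Fin N) (Fin N) ℂ).IsHermitian := a.2
  exact ⟨ha.finite_spectrum_real, by simpa using ha.ncard_spectrum_real_le⟩

theorem nonDerogatory_iff_ncard_spectrum {N : ℕ} (a : selfAdjoint (Matrix (Fin N) (Fin N) ℂ)) :
    NonDerogatory (a : Matrix (Fin N) (Fin N) ℂ) ↔
      (spectrum ℝ (a : Matrix (Fin N) (Fin N) ℂ)).ncard = N := by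
  have ha : (a : Matrix (Fin N) (Fin N) ℂ).IsHermitian := a.2
  simpa using ha.nonDerogatory_iff_ncard

theorem mainTheorem8 :
    (∀ (k : ℕ) (n : Fin k → ℕ) (I : Set (selfAdjoint (BlockAlgebra n))), IsIsocone I →
      ∀ a ∈ interior I, NonDerogatory (Matrix.blockDiagonal' (a : BlockAlgebra n)) →
        (∃ P : PartialOrder (Fin (∑ x, n x)), ∀ i j, P.le i j ↔ IndexLE I a i j) ∧
        ∃ ε > 0, ∀ a' : selfAdjoint (BlockAlgebra n), ‖a - a'‖ < ε →
          a' ∈ interior I ∧ NonDerogatory (Matrix.blockDiagonal' (a' : BlockAlgebra n)) ∧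
          ∀ i j : Fin (∑ x, n x), IndexLE I a' i j ↔ IndexLE I a i j) ∧
    (∀ (N : ℕ) (I : Set (selfAdjoint (Matrix (Fin N) (Fin N) ℂ))), IsIsocone I →
      ∃! P : PartialOrder (Fin N), ∀ a ∈ interior I,
        NonDerogatory (a : Matrix (Fin N) (Fin N) ℂ) →
          ∀ i j, P.le i j ↔ IndexLE I a i j) := by
  constructor
  · intro k n I hI a ha haN
    rw [nonDerogatory_blockDiagonal'_iff] at haN
    obtain ⟨s⟩ := (nonempty_orderIso_iff (finite_spectrum_blockAlgebra a).1).2 haN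
    refine ⟨exists_partialOrder_indexLE (interior_subset ha) s, ?_⟩
    obtain ⟨ε, hε, h⟩ := Metric.eventually_nhds_iff.1
      (eventually_indexLE_iff hI finite_spectrum_blockAlgebra ha haN)
    refine ⟨ε, hε, fun a' ha' => ?_⟩
    rw [nonDerogatory_blockDiagonal'_iff]
    exact h (by rwa [dist_comm, dist_eq_norm])
  · intro N I hI
    -- This one `a` defines the order, and its existence also gives uniqueness.
    obtain ⟨a, ha, haN⟩ := exists_nonDerogatory_mem isOpen_interior hI.interior_nonempty
    obtain ⟨s⟩ := (nonempty_orderIso_iff (finite_spectrum_matrix a).1).2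
      ((nonDerogatory_iff_ncard_spectrum a).1 haN)
    obtain ⟨P, hP⟩ := exists_partialOrder_indexLE (interior_subset ha) s
    refine ⟨P, fun b hb hbN i j => ?_, fun P' hP' => ?_⟩
    · rw [hP]
      refine iff_of_eq (eq_of_locally_constant_nonDerogatory isOpen_interior hI.convex.interior
        (fun c => IndexLE I c i j) (fun c hc hcN => ?_) ha hb haN hbN)
      filter_upwards [eventually_indexLE_iff hI finite_spectrum_matrix hc
        ((nonDerogatory_iff_ncard_spectrum c).1 hcN)] with c' hc'
      exact propext (hc'.2.2 i j)
    · exact PartialOrder.ext fun i j => (hP' a ha haN i j).trans (hP i j).symm
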